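/- **Setting.** Let $q,m\ge 1$ and $n\ge 0$ be integers. Let $C\subseteq\mathbb{R}^q$ and $D\subseteq\mathbb{R}^m$ be convex cones that are non-trivial ($\{0\}\subsetneq C\subsetneq\mathbb R^q$, likewise for $D$), pointed (they contain no line) and solid (non-empty interior), and write $v\le_C w$ for $w-v\in C$. Let $X\subseteq\mathbb{R}^n$ be convex, and let $\Gamma:X\to\mathbb{R}^q$ be $C$-convex and $g:X\to\mathbb{R}^m$ be $D$-convex, i.e. $\Gamma(\alpha x+(1-\alpha)y)\le_C\alpha\Gamma(x)+(1-\alpha)\Gamma(y)$ for $x,y\in X$, $\alpha\in[0,1]$, and similarly for $g$. Consider $$\text{(P)}\qquad \text{minimize } \Gamma(x)\ \text{ with respect to } \le_C\ \text{ subject to } g(x)\le_D 0,$$ with feasible set $\mathcal X=\{x\in X: g(x)\le_D 0\}\neq\emptyset$ and upper image $\mathcal P=\operatorname{cl}(\Gamma(\mathcal X)+C)$. Problem (P) is bounded if $\mathcal P\subseteq\{y\}+C$ for some $y\in\mathbb{R}^q$. Let $C^+=\{z: z^Ty\ge 0\ \forall y\in C\}$. Assume: (a) $\mathcal X$ is compact;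 (b) $\mathcal X$ has non-empty interior; (c) $\Gamma$ is continuous on $X$; (d) $C$ is polyhedral and $D=\mathbb{R}^m_+$. Fix $c\in\operatorname{int}C$ and vectors $c^1,\dots,c^{q-1}$ such that $c^1,\dots,c^{q-1},c$ are linearly independent, let $T=(c^1,\dots,c^{q-1},c)$ be the matrix with these columns, and put $w(t)=\big((t_1,\dots,t_{q-1},1)T^{-1}\big)^T$ for $t\in\mathbb R^q$. Let $e^q$ be the last unit vector, $K=\mathbb{R}_+e^q$, $\mathcal T=\{t: w(t)\in C^+\}$ and $$D^*(t)=\Big(t_1,\dots,t_{q-1},\inf_{x\in\mathcal X}w(t)^T\Gamma(x)\Big)^T,\qquad \mathcal D=D^*(\mathcal T)-K,\qquad \varphi(y,y^*)=w(y^*)^Ty-y^*_q .$$ The geometric dual problem (D) is to maximize $D^*(t)$ with respect to $\le_K$ subject to $t\in\mathcal T$; $\mathcal D$ is its lower image. **Solutions.** Let $\epsilon>0$. A *finite weak $\epsilon$-solution* of the bounded problem (P) is a non-empty finite set $\bar{\mathcal X}\subseteq\mathcal X$ with $\operatorname{conv}\Gamma(\bar{\mathcal X})+C-\epsilon\{c\}\supseteq\mathcal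 P$ all of whose elements $\bar x$ are weak minimizers, i.e. $(\{\Gamma(\bar x)\}-\operatorname{int}C)\cap\Gamma(\mathcal X)=\emptyset$. A *finite $\epsilon$-solution* of (D) is a non-empty finite set $\bar{\mathcal T}\subseteq\mathcal T$ with $\operatorname{conv}D^*(\bar{\mathcal T})-K+\epsilon\{e^q\}\supseteq\mathcal D$ all of whose elements $\bar t$ are maximizers, i.e. there is no $t\in\mathcal T$ with $D^*(t)\ge_K D^*(\bar t)$ and $D^*(t)\ne D^*(\bar t)$. **Algorithm.** Let $z^1,\dots,z^J$ be vectors generating the cone $C^+$ with $c^Tz^j=1$ for all $j$, and let $Z$ be the matrix with columns $z^1,\dots,z^J$. For $v\in\mathbb R^q$ consider the scalar problems $$(\mathrm P_2(v))\quad \min\{s\in\mathbb R:\ x\in X,\ g(x)\le 0,\ Z^T(\Gamma(x)-sc-v)\le 0\},$$ $$(\mathrm D_2(v))\quad \max\Big\{\inf_{x\in X}\{u^Tg(x)+w^T\Gamma(x)\}-w^Tv:\ u\ge 0,\ w\in C^+,\ w^Tc=1\Big\}.$$ 1. For $j=1,\dots,J$ compute an optimal solution $x^j$ of $\min\{(z^j)^T\Gamma(x):x\in\mathcal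 X\}$. Set $\mathcal P_0=\bigcap_j\{y:(z^j)^Ty\ge (z^j)^T\Gamma(x^j)\}$, $k=0$, $\bar{\mathcal X}=\{x^1,\dots,x^J\}$, $\bar{\mathcal T}=\{T^Tz^1,\dots,T^Tz^J\}$. 2. Set $M=\mathbb{R}^q$ and list the vertices of $\mathcal P_k$ in some order. For each vertex $v$ in turn, compute optimal solutions $(x^v,s^v)$ of $(\mathrm P_2(v))$ and $(u^v,w^v)$ of $(\mathrm D_2(v))$, add $x^v$ to $\bar{\mathcal X}$ and $T^Tw^v$ to $\bar{\mathcal T}$; if $s^v>\epsilon$, replace $M$ by $M\cap\{y:\varphi(y,D^*(T^Tw^v))\ge 0\}$ and (optional break) leave this loop over the vertices. 3. If $M\ne\mathbb{R}^q$, set $\mathcal P_{k+1}=\mathcal P_k\cap M$, increase $k$ by one and go to step 2. If $M=\mathbb{R}^q$, stop and return $\bar{\mathcal X}$ and $\bar{\mathcal T}$ (together with the vertices of $\{y:\varphi(y,y^*)\ge0\ \forall y^*\in D^*(\bar{\mathcal T})\}$ and the set $\Gamma(\bar{\mathcal X})$). **Theorem.** Under these assumptions, for every $\epsilon>0$, both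 with and without the optional break and whatever optimal solutions and orderings of vertices are chosen: if the algorithm terminates, then (P) is bounded, the returned set $\bar{\mathcal X}$ is a finite weak $\epsilon$-solution of (P), and the returned set $\bar{\mathcal T}$ is a finite $\epsilon$-solution of the geometric dual problem (D). -/

import Mathlib

open Set Matrix
open scoped Pointwise

noncomputable section

namespace CVOPAlg

/- Euclidean space `ℝ^k` is modelled by `Fin k → ℝ`; only its linear structure, its (Euclidean)
topology and the scalar product `w ⬝ᵥ y = wᵀ y` are used, never a norm.
Image dimensions are written `q = r + 1`, so that `Fin.last r` is the `q`-th coordinate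
(a non-trivial cone in `ℝ^q` forces `q ≥ 1`). -/

/-- A polyhedral convex set: a finite intersection of closed half-spaces. -/
def IsPolyhedral {k : ℕ} (A : Set (Fin k → ℝ)) : Prop :=
  ∃ (s : ℕ) (w : Fin s → (Fin k → ℝ)) (γ : Fin s → ℝ),
    (∀ i, w i ≠ 0) ∧ A = ⋂ i, {y | γ i ≤ w i ⬝ᵥ y}

/-- `A` contains no line. -/
def ContainsNoLine {k : ℕ} (A : Set (Fin k → ℝ)) : Prop :=
  ¬ ∃ a d : Fin k → ℝ, d ≠ 0 ∧ ∀ s : ℝ, a + s • d ∈ A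

/-- A non-trivial, pointed (line-free), solid convex cone. -/
structure IsOrderingCone {k : ℕ} (C : PointedCone ℝ (Fin k → ℝ)) : Prop where
  ne_bot : (C : Set (Fin k → ℝ)) ≠ {0}
  ne_top : (C : Set (Fin k → ℝ)) ≠ univ
  pointed : ContainsNoLine (C : Set (Fin k → ℝ))
  solid : (interior (C : Set (Fin k → ℝ))).Nonempty

/-- The partial order `v ≤_C w`. -/
def coneLE {k : ℕ} (C : PointedCone ℝ (Fin k → ℝ)) (v w : Fin k → ℝ) : Prop := w - v ∈ C

/-- `f : X → ℝ^k` is `C`-convex (the values of `f` outside `X` play no role). -/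
def IsConeConvexOn {n k : ℕ} (C : PointedCone ℝ (Fin k → ℝ)) (X : Set (Fin n → ℝ))
    (f : (Fin n → ℝ) → (Fin k → ℝ)) : Prop :=
  ∀ x ∈ X, ∀ y ∈ X, ∀ α : ℝ, 0 ≤ α → α ≤ 1 →
    coneLE C (f (α • x + (1 - α) • y)) (α • f x + (1 - α) • f y)

/-- The positive dual cone `C⁺`. -/
def dualCone {k : ℕ} (C : PointedCone ℝ (Fin k → ℝ)) : Set (Fin k → ℝ) :=
  {z | ∀ y ∈ C, 0 ≤ z ⬝ᵥ y}

/-- `y` is a weakly `C`-minimal element of `A`. -/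
def IsWeaklyMinimal {k : ℕ} (C : PointedCone ℝ (Fin k → ℝ)) (A : Set (Fin k → ℝ))
    (y : Fin k → ℝ) : Prop :=
  y ∈ A ∧ ({y} - interior (C : Set (Fin k → ℝ))) ∩ A = ∅

/-- A (feasible) convex vector optimization problem
`minimize Γ(x) w.r.t. ≤_C subject to x ∈ X, g(x) ≤_D 0`. -/
structure CVOP (n m r : ℕ) where
  /-- the ground set -/
  X : Set (Fin n → ℝ)
  /-- the cone ordering the objective space `ℝ^q`, `q = r + 1` -/
  C : PointedCone ℝ (Fin (r + 1) → ℝ)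
  /-- the cone ordering the constraint space -/
  D : PointedCone ℝ (Fin m → ℝ)
  /-- the objective function -/
  Γ : (Fin n → ℝ) → (Fin (r + 1) → ℝ)
  /-- the constraint function -/
  g : (Fin n → ℝ) → (Fin m → ℝ)
  convex_X : Convex ℝ X
  cone_C : IsOrderingCone C
  cone_D : IsOrderingCone D
  convex_Γ : IsConeConvexOn C X Γ
  convex_g : IsConeConvexOn D X g
  feasible_nonempty : ∃ x ∈ X, coneLE D (g x) 0

namespace CVOP

variable {n m r : ℕ} (P : CVOP n m r)

/-- The feasible set `𝒳`. -/
def feasible : Set (Fin n → ℝ) := {x | x ∈ P.X ∧ coneLE P.D (P.g x) 0}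

/-- The upper image `𝒫 = cl (Γ(𝒳) + C)`. -/
def upperImage : Set (Fin (r + 1) → ℝ) :=
  closure (P.Γ '' P.feasible + (P.C : Set (Fin (r + 1) → ℝ)))

/-- The problem is bounded: `𝒫 ⊆ {y} + C` for some `y`. -/
def IsBoundedProblem : Prop :=
  ∃ y : Fin (r + 1) → ℝ, P.upperImage ⊆ {y} + (P.C : Set (Fin (r + 1) → ℝ))

/-- The standing assumption of the algorithms. -/
structure Assumption : Prop where
  compact : IsCompact P.feasible
  interior_nonempty : (interior P.feasible).Nonempty
  continuous : ContinuousOn P.Γ P.X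
  polyhedral : IsPolyhedral (P.C : Set (Fin (r + 1) → ℝ))
  orthant : (P.D : Set (Fin m → ℝ)) = {y | ∀ i, 0 ≤ y i}

/-- `x` is a weak minimizer. -/
def IsWeakMinimizer (x : Fin n → ℝ) : Prop :=
  x ∈ P.feasible ∧ IsWeaklyMinimal P.C (P.Γ '' P.feasible) (P.Γ x)

/-- `Xbar` is a finite `ε`-infimizer of the (bounded) problem, with respect to the fixed
direction `c`. -/
def IsFiniteEpsInfimizer (c : Fin (r + 1) → ℝ) (ε : ℝ) (Xbar : Set (Fin n → ℝ)) : Prop :=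
  P.IsBoundedProblem ∧ Xbar.Nonempty ∧ Xbar.Finite ∧ Xbar ⊆ P.feasible ∧
    P.upperImage ⊆ convexHull ℝ (P.Γ '' Xbar) + (P.C : Set (Fin (r + 1) → ℝ)) - {ε • c}

/-- `Xbar` is a finite weak `ε`-solution. -/
def IsFiniteWeakEpsSolution (c : Fin (r + 1) → ℝ) (ε : ℝ) (Xbar : Set (Fin n → ℝ)) : Prop :=
  P.IsFiniteEpsInfimizer c ε Xbar ∧ ∀ x ∈ Xbar, P.IsWeakMinimizer x

end CVOP

section GeometricDual

variable {r : ℕ}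

/-- The family `c¹, …, c^{q-1}, c`. -/
def frame (c' : Fin r → (Fin (r + 1) → ℝ)) (c : Fin (r + 1) → ℝ) :
    Fin (r + 1) → (Fin (r + 1) → ℝ) :=
  Fin.snoc (α := fun _ => Fin (r + 1) → ℝ) c' c

/-- The matrix `T = (c¹, …, c^{q-1}, c)` with these vectors as columns. -/
def matT (c' : Fin r → (Fin (r + 1) → ℝ)) (c : Fin (r + 1) → ℝ) :
    Matrix (Fin (r + 1)) (Fin (r + 1)) ℝ :=
  Matrix.of fun i j => frame c' c j i

/-- `w(t) = ((t₁, …, t_{q-1}, 1) T⁻¹)ᵀ`. -/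
def wt (c' : Fin r → (Fin (r + 1) → ℝ)) (c t : Fin (r + 1) → ℝ) : Fin (r + 1) → ℝ :=
  Function.update t (Fin.last r) 1 ᵥ* (matT c' c)⁻¹

/-- The coupling function `φ(y, y*) = (y*₁, …, y*_{q-1}, 1) T⁻¹ y - y*_q`. -/
def phi (c' : Fin r → (Fin (r + 1) → ℝ)) (c y ystar : Fin (r + 1) → ℝ) : ℝ :=
  wt c' c ystar ⬝ᵥ y - ystar (Fin.last r)

/-- The last unit vector `e^q`. -/
def eLast : Fin (r + 1) → ℝ := Pi.single (Fin.last r) 1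

/-- The cone `K = ℝ₊ e^q`. -/
def coneK : Set (Fin (r + 1) → ℝ) := {y | ∃ a : ℝ, 0 ≤ a ∧ y = a • eLast}

end GeometricDual

namespace CVOP

variable {n m r : ℕ} (P : CVOP n m r) (c' : Fin r → (Fin (r + 1) → ℝ)) (c : Fin (r + 1) → ℝ)

/-- The dual feasible set `𝒯 = {t : w(t) ∈ C⁺}`. -/
def dualFeasible : Set (Fin (r + 1) → ℝ) := {t | wt c' c t ∈ dualCone P.C}

/-- The dual objective `D*(t) = (t₁, …, t_{q-1}, inf_{x ∈ 𝒳} w(t)ᵀ Γ(x))`. The infimum is that of a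
nonempty bounded-below set of reals whenever `𝒳` is compact and `Γ` is continuous. -/
def dualObj (t : Fin (r + 1) → ℝ) : Fin (r + 1) → ℝ :=
  Function.update t (Fin.last r) (sInf ((fun x => wt c' c t ⬝ᵥ P.Γ x) '' P.feasible))

/-- The lower image `𝒟 = D*(𝒯) - K`. -/
def lowerImage : Set (Fin (r + 1) → ℝ) := P.dualObj c' c '' P.dualFeasible c' c - coneK

/-- `t` is a maximizer of the geometric dual problem. -/
def IsMaximizer (t : Fin (r + 1) → ℝ) : Prop :=
  t ∈ P.dualFeasible c' c ∧
    ¬ ∃ s ∈ P.dualFeasible c' c,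
      P.dualObj c' c s - P.dualObj c' c t ∈ coneK ∧ P.dualObj c' c s ≠ P.dualObj c' c t

/-- `Tbar` is a finite `ε`-supremizer of the geometric dual problem. -/
def IsFiniteEpsSupremizer (ε : ℝ) (Tbar : Set (Fin (r + 1) → ℝ)) : Prop :=
  Tbar.Nonempty ∧ Tbar.Finite ∧ Tbar ⊆ P.dualFeasible c' c ∧
    P.lowerImage c' c ⊆ convexHull ℝ (P.dualObj c' c '' Tbar) - coneK + {ε • eLast}

/-- `Tbar` is a finite `ε`-solution of the geometric dual problem. -/
def IsFiniteEpsDualSolution (ε : ℝ) (Tbar : Set (Fin (r + 1) → ℝ)) : Prop :=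
  P.IsFiniteEpsSupremizer c' c ε Tbar ∧ ∀ t ∈ Tbar, P.IsMaximizer c' c t

end CVOP

/-! ### The scalar problems -/

namespace CVOP

variable {n m r : ℕ} (P : CVOP n m r)

/-- `x` is an optimal solution of the weighted sum scalarization
`min {wᵀ Γ(x) : x ∈ X, g(x) ≤ 0}`. -/
def IsOptimalP1 (w : Fin (r + 1) → ℝ) (x : Fin n → ℝ) : Prop :=
  x ∈ P.feasible ∧ ∀ x' ∈ P.feasible, w ⬝ᵥ P.Γ x ≤ w ⬝ᵥ P.Γ x'

variable {J : ℕ} (z : Fin J → (Fin (r + 1) → ℝ)) (c v : Fin (r + 1) → ℝ)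

/-- `(x, s)` is feasible for `min {s : x ∈ X, g(x) ≤ 0, Zᵀ (Γ(x) - s c - v) ≤ 0}`, where the columns
of `Z` are the `z j`. -/
def IsFeasibleP2 (x : Fin n → ℝ) (s : ℝ) : Prop :=
  x ∈ P.X ∧ (∀ i, P.g x i ≤ 0) ∧ ∀ j, z j ⬝ᵥ (P.Γ x - s • c - v) ≤ 0

/-- `(x, s)` is an optimal solution of that problem. -/
def IsOptimalP2 (x : Fin n → ℝ) (s : ℝ) : Prop :=
  P.IsFeasibleP2 z c v x s ∧ ∀ x' s', P.IsFeasibleP2 z c v x' s' → s ≤ s'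

/-- The feasible pairs of the Lagrangian dual: `u ≥ 0`, `w ∈ C⁺`, `wᵀ c = 1`. -/
def IsFeasibleD2 (u : Fin m → ℝ) (w : Fin (r + 1) → ℝ) : Prop :=
  (∀ i, 0 ≤ u i) ∧ w ⬝ᵥ c = 1 ∧ w ∈ dualCone P.C

/-- Its objective `inf_{x ∈ X} {uᵀ g(x) + wᵀ Γ(x)} - wᵀ v`, an extended real. -/
def objD2 (u : Fin m → ℝ) (w : Fin (r + 1) → ℝ) : EReal :=
  ⨅ x ∈ P.X, ((u ⬝ᵥ P.g x + w ⬝ᵥ P.Γ x - w ⬝ᵥ v : ℝ) : EReal)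

/-- `(u, w)` is an optimal solution of the Lagrangian dual. -/
def IsOptimalD2 (u : Fin m → ℝ) (w : Fin (r + 1) → ℝ) : Prop :=
  P.IsFeasibleD2 c u w ∧ ∀ u' w', P.IsFeasibleD2 c u' w' → P.objD2 v u' w' ≤ P.objD2 v u w

end CVOP

/-! ### The Primal Approximation Algorithm -/

/-- `z¹, …, z^J` are generating vectors of `C⁺`, normalized by `cᵀ z^j = 1`. -/
def IsNormalizedDualGenerators {r J : ℕ} (C : PointedCone ℝ (Fin (r + 1) → ℝ))
    (c : Fin (r + 1) → ℝ) (z : Fin J → (Fin (r + 1) → ℝ)) : Prop :=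
  (∀ j, c ⬝ᵥ z j = 1) ∧
    dualCone C = {w | ∃ a : Fin J → ℝ, (∀ j, 0 ≤ a j) ∧ w = ∑ j, a j • z j}

/-- Program variables that change inside the `for` loop. -/
structure LoopState (n r : ℕ) where
  Xbar : Set (Fin n → ℝ)
  Tbar : Set (Fin (r + 1) → ℝ)
  M : Set (Fin (r + 1) → ℝ)

/-- Program variables at the head of the `repeat` loop; `outer` is the current outer approximation
`P_k` (a polyhedron, identified with the set it represents). -/
structure State (n r : ℕ) where
  Xbar : Set (Fin n → ℝ)
  Tbar : Set (Fin (r + 1) → ℝ)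
  outer : Set (Fin (r + 1) → ℝ)

/-- The data returned by the algorithm. -/
structure Output (n r : ℕ) where
  Xbar : Set (Fin n → ℝ)
  Tbar : Set (Fin (r + 1) → ℝ)
  outerVertices : Set (Fin (r + 1) → ℝ)
  innerPoints : Set (Fin (r + 1) → ℝ)

section Algorithm

variable {n m r J : ℕ} (P : CVOP n m r) (c' : Fin r → (Fin (r + 1) → ℝ)) (c : Fin (r + 1) → ℝ)
  (z : Fin J → (Fin (r + 1) → ℝ)) (ε : ℝ) (brk : Bool)

/-- The half-space `{y : φ(y, D*(t)) ≥ 0}`. -/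
def cutHalfspace (t : Fin (r + 1) → ℝ) : Set (Fin (r + 1) → ℝ) :=
  {y | 0 ≤ phi c' c y (P.dualObj c' c t)}

/-- Execution of the `for` loop over a list of vertices: `ForLoop … vs s s'` says that, started in
`s` with the vertices `vs` still to be visited, the loop can be left in `s'`. At a vertex `v`
arbitrary optimal solutions `(x, s)` and `(u, w)` of the two scalar problems at `v` are computed,
`x` is added to `Xbar`, `Tᵀ w` to `Tbar`, and `M` is cut if `s > ε`; after a cut the loop is left
if the flag `brk` of the optional `break` is set. -/
inductive ForLoop : List (Fin (r + 1) → ℝ) → LoopState n r → LoopState n r → Prop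
  | done (st : LoopState n r) : ForLoop [] st st
  | pass (v : Fin (r + 1) → ℝ) (vs : List (Fin (r + 1) → ℝ)) (st st' : LoopState n r)
      (x : Fin n → ℝ) (s : ℝ) (u : Fin m → ℝ) (w : Fin (r + 1) → ℝ)
      (hP2 : P.IsOptimalP2 z c v x s) (hD2 : P.IsOptimalD2 c v u w) (hs : s ≤ ε)
      (rest : ForLoop vs ⟨insert x st.Xbar, insert ((matT c' c)ᵀ *ᵥ w) st.Tbar, st.M⟩ st') :
      ForLoop (v :: vs) st st'
  | cut (v : Fin (r + 1) → ℝ) (vs : List (Fin (r + 1) → ℝ)) (st st' : LoopState n r)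
      (x : Fin n → ℝ) (s : ℝ) (u : Fin m → ℝ) (w : Fin (r + 1) → ℝ)
      (hP2 : P.IsOptimalP2 z c v x s) (hD2 : P.IsOptimalD2 c v u w) (hs : ε < s)
      (hbrk : brk = false)
      (rest : ForLoop vs ⟨insert x st.Xbar, insert ((matT c' c)ᵀ *ᵥ w) st.Tbar,
        st.M ∩ cutHalfspace P c' c ((matT c' c)ᵀ *ᵥ w)⟩ st') :
      ForLoop (v :: vs) st st'
  | cutBreak (v : Fin (r + 1) → ℝ) (vs : List (Fin (r + 1) → ℝ)) (st : LoopState n r)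
      (x : Fin n → ℝ) (s : ℝ) (u : Fin m → ℝ) (w : Fin (r + 1) → ℝ)
      (hP2 : P.IsOptimalP2 z c v x s) (hD2 : P.IsOptimalD2 c v u w) (hs : ε < s)
      (hbrk : brk = true) :
      ForLoop (v :: vs) st ⟨insert x st.Xbar, insert ((matT c' c)ᵀ *ᵥ w) st.Tbar,
        st.M ∩ cutHalfspace P c' c ((matT c' c)ᵀ *ᵥ w)⟩

/-- The initial state obtained from optimal solutions `x j` of the weighted sum problems with
weights `z j`. -/
def initState (x : Fin J → (Fin n → ℝ)) : State n r where
  Xbar := range x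
  Tbar := range fun j => (matT c' c)ᵀ *ᵥ z j
  outer := ⋂ j, {y | z j ⬝ᵥ P.Γ (x j) ≤ z j ⬝ᵥ y}

/-- One execution of the body of the `repeat` loop up to its final test: the vertices of the current
outer approximation are listed in some order and processed by the `for` loop, starting with
`M = ℝ^q`. -/
def BodyRun (st : State n r) (st' : LoopState n r) : Prop :=
  ∃ vs : List (Fin (r + 1) → ℝ), vs.Nodup ∧ (∀ v, v ∈ vs ↔ v ∈ extremePoints ℝ st.outer) ∧
    ForLoop P c' c z ε brk vs ⟨st.Xbar, st.Tbar, univ⟩ st'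

/-- The states that an execution can have at the head of the `repeat` loop. -/
inductive Reachable : State n r → Prop
  | init (x : Fin J → (Fin n → ℝ)) (hx : ∀ j, P.IsOptimalP1 (z j) (x j)) :
      Reachable (initState P c' c z x)
  | next (st : State n r) (st' : LoopState n r) (h : Reachable st)
      (hbody : BodyRun P c' c z ε brk st st') (hM : st'.M ≠ univ) :
      Reachable ⟨st'.Xbar, st'.Tbar, st.outer ∩ st'.M⟩

/-- Some execution of the algorithm terminates (the body of the `repeat` loop ends with `M = ℝ^q`)
and returns `out`. -/
def Returns (out : Output n r) : Prop :=
  ∃ (st : State n r) (st' : LoopState n r), Reachable P c' c z ε brk st ∧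
    BodyRun P c' c z ε brk st st' ∧ st'.M = univ ∧
    out = { Xbar := st'.Xbar
            Tbar := st'.Tbar
            outerVertices := extremePoints ℝ
              {y | ∀ ystar ∈ P.dualObj c' c '' st'.Tbar, 0 ≤ phi c' c y ystar}
            innerPoints := P.Γ '' st'.Xbar }

end Algorithm

end CVOPAlg

end

/-!
Every half-space used by the algorithm has a normal `w ∈ C⁺` with `wᵀ c = 1` and level
`inf {wᵀ Γ(x) : x ∈ 𝒳}`, so each outer approximation contains the upper image. The generators `z j`
of `C⁺` are among these normals, hence each outer approximation is bounded below with respect to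
the pointed cone `C`. Any cut removes points from `ℝ^q`; if the last pass through the loop ends with
`M = ℝ^q`, then no cut was made, and every vertex `v` of the last outer approximation satisfies
`v ∈ Γ(x^v) + C - ε {c}`.

The primal claim follows because a closed set that is bounded below with respect to `C` lies in every
closed convex set `Q` with `Q + C ⊆ Q` that contains its extreme points
(`CVOPAlg.subset_of_extremePoints_subset`). With `Q = conv Γ(X̄) + C - ε {c}` this gives the chain
`𝒫 ⊆ outer approximation ⊆ Q`. Weak minimality of the collected points is read off from the
optimality of the scalar problems.

For the dual claim, every dual feasible point is a maximizer, as its first `q - 1` coordinates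
determine its dual objective (`CVOPAlg.CVOP.isMaximizer_of_mem_dualFeasible`). Every `y` that
satisfies all cuts of `T̄` lies in the last outer approximation, hence in `Q`, so that
`wᵀ y ≥ inf wᵀ Γ - ε` for all normalized `w ∈ C⁺`; by linear programming duality, carried out as a
separation argument in `CVOPAlg.CVOP.isFiniteEpsSupremizer_of_cuts`, this says that `T̄` is a finite
`ε`-supremizer.
-/

namespace CVOPAlg

/-! ### Linear functionals and cones generated by finitely many functionals -/

/-- A linear functional on `ℝ^k` is the scalar product with a vector. -/
lemma exists_dotProduct_eq {k : ℕ} (f : (Fin k → ℝ) →ₗ[ℝ] ℝ) :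
    ∃ h : Fin k → ℝ, ∀ y, f y = h ⬝ᵥ y := by
  refine ⟨fun i => f (Pi.single i 1), fun y => ?_⟩
  rw [LinearMap.pi_apply_eq_sum_univ f y]
  refine Finset.sum_congr rfl fun i _ => ?_
  rw [smul_eq_mul, mul_comm]
  congr 2
  ext j
  simp [Pi.single_apply, eq_comm]

lemma continuous_dotProduct_right {k : ℕ} (w : Fin k → ℝ) :
    Continuous fun y : Fin k → ℝ => w ⬝ᵥ y :=
  continuous_const.dotProduct continuous_id

lemma sum_smul_dotProduct_eq {k J : ℕ} (a : Fin J → ℝ) (z : Fin J → (Fin k → ℝ)) (y : Fin k → ℝ) :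
    (∑ j, a j • z j) ⬝ᵥ y = ∑ j, a j * (z j ⬝ᵥ y) := by
  rw [sum_dotProduct]
  simp only [smul_dotProduct, smul_eq_mul]

/-- If `d` is interior to the cone `C`, then `d - δ c ∈ C` for some `δ > 0`. -/
lemma exists_sub_smul_mem {k : ℕ} {C : PointedCone ℝ (Fin k → ℝ)} {d : Fin k → ℝ}
    (hd : d ∈ interior (C : Set (Fin k → ℝ))) (c : Fin k → ℝ) :
    ∃ δ : ℝ, 0 < δ ∧ d - δ • c ∈ C := by
  have hcont : Continuous fun δ : ℝ => d - δ • c := by fun_prop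
  have hmem : (fun δ : ℝ => d - δ • c) ⁻¹' interior (C : Set (Fin k → ℝ)) ∈ nhds (0 : ℝ) :=
    (isOpen_interior.preimage hcont).mem_nhds (by simpa using hd)
  obtain ⟨η, hη, hball⟩ := Metric.mem_nhds_iff.1 hmem
  refine ⟨η / 2, by positivity, interior_subset (hball ?_)⟩
  rw [Metric.mem_ball, Real.dist_eq, sub_zero, abs_of_pos (by positivity)]
  linarith

lemma IsNormalizedDualGenerators.mem_dualCone {r J : ℕ} {C : PointedCone ℝ (Fin (r + 1) → ℝ)}
    {c : Fin (r + 1) → ℝ} {z : Fin J → (Fin (r + 1) → ℝ)}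
    (hz : IsNormalizedDualGenerators C c z) (j : Fin J) : z j ∈ dualCone C := by
  rw [hz.2]
  refine ⟨Pi.single j 1, fun i => ?_, ?_⟩
  · by_cases h : i = j
    · subst h; simp
    · simp [h]
  · simp [Pi.single_apply, ite_smul]

/-- The bipolar theorem for a polyhedral cone: `C` is cut out by the generators of `C⁺`. -/
lemma mem_cone_iff_forall_generators {r J : ℕ} {C : PointedCone ℝ (Fin (r + 1) → ℝ)}
    (hC : IsPolyhedral (C : Set (Fin (r + 1) → ℝ))) {c : Fin (r + 1) → ℝ}
    {z : Fin J → (Fin (r + 1) → ℝ)} (hz : IsNormalizedDualGenerators C c z)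
    (y : Fin (r + 1) → ℝ) : y ∈ C ↔ ∀ j, 0 ≤ z j ⬝ᵥ y := by
  refine ⟨fun hy j => hz.mem_dualCone j y hy, fun h => ?_⟩
  obtain ⟨s, w, γ, -, hCw⟩ := hC
  have hmem : ∀ x, x ∈ C ↔ ∀ i, γ i ≤ w i ⬝ᵥ x := fun x => by
    rw [← SetLike.mem_coe, hCw]; simp
  rw [hmem]
  intro i
  have h0 : γ i ≤ 0 := by simpa using (hmem 0).1 C.zero_mem i
  refine h0.trans ?_
  -- Each normal vector `w i` is non-negative on `C`, since `C` is closed under scaling.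
  have hwi : w i ∈ dualCone C := by
    intro x hx
    by_contra! hneg
    have ht : 0 ≤ (1 - γ i) / -(w i ⬝ᵥ x) := div_nonneg (by linarith) (by linarith)
    have h1 := (hmem _).1 (C.smul_mem ht hx) i
    rw [dotProduct_smul, smul_eq_mul, div_mul_eq_mul_div, mul_div_assoc] at h1
    rw [div_neg, div_self hneg.ne] at h1
    linarith
  rw [hz.2] at hwi
  obtain ⟨a, ha, hwa⟩ := hwi
  rw [hwa, sum_smul_dotProduct_eq]
  exact Finset.sum_nonneg fun j _ => mul_nonneg (ha j) (h j)

/-- A line-free cone cut out by the `z j` forces the `z j` to separate the origin. -/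
lemma eq_zero_of_forall_generators {k J : ℕ} {C : PointedCone ℝ (Fin k → ℝ)}
    (hC : ContainsNoLine (C : Set (Fin k → ℝ))) {z : Fin J → (Fin k → ℝ)}
    (hz : ∀ y, y ∈ C ↔ ∀ j, 0 ≤ z j ⬝ᵥ y) {d : Fin k → ℝ} (hd : ∀ j, z j ⬝ᵥ d = 0) : d = 0 := by
  by_contra hne
  refine hC ⟨0, d, hne, fun s => ?_⟩
  rw [SetLike.mem_coe, hz]
  intro j
  simp [hd j]

/-! ### Extreme points of closed sets bounded below with respect to a cone -/

/-- On a closed set bounded below in every coordinate `z j`, a functional with strictly positive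
coefficients in the `z j` attains its minimum at an extreme point: its sublevel sets are compact, so
that the Krein–Milman lemma applies to the set of minimizers. -/
lemma exists_extremePoint_isMinOn {k J : ℕ} {z : Fin J → (Fin k → ℝ)}
    (hsep : ∀ d, (∀ j, z j ⬝ᵥ d = 0) → d = 0) {A : Set (Fin k → ℝ)} (hA : IsClosed A)
    (hne : A.Nonempty) {N : ℝ} (hN : ∀ y ∈ A, ∀ j, N ≤ z j ⬝ᵥ y) {a : Fin J → ℝ}
    (ha : ∀ j, 0 < a j) :
    ∃ v ∈ extremePoints ℝ A, ∀ y ∈ A, (∑ j, a j • z j) ⬝ᵥ v ≤ (∑ j, a j • z j) ⬝ᵥ y := by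
  set w := ∑ j, a j • z j with hw
  let ev : (Fin k → ℝ) →ₗ[ℝ] (Fin J → ℝ) :=
    { toFun := fun y j => z j ⬝ᵥ y
      map_add' := fun x y => by ext j; simp [dotProduct_add]
      map_smul' := fun t y => by ext j; simp [dotProduct_smul] }
  have hev : Topology.IsClosedEmbedding ev := by
    refine LinearMap.isClosedEmbedding_of_injective (LinearMap.ker_eq_bot'.2 fun d hd => ?_)
    exact hsep d fun j => congrFun hd j
  have hcomp : ∀ α : ℝ, IsCompact (A ∩ {y | w ⬝ᵥ y ≤ α}) := by
    intro α
    -- The upper bound on `z j ⬝ᵥ y` obtained by estimating all other terms of `w ⬝ᵥ y` by `N`.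
    let b : Fin J → ℝ := fun j => N + (α - ∑ i, a i * N) / a j
    refine (hev.isCompact_preimage (isCompact_Icc (a := fun _ => N) (b := b))).of_isClosed_subset
      (hA.inter (isClosed_le (continuous_dotProduct_right w) continuous_const)) ?_
    rintro y ⟨hyA, hyα⟩
    refine ⟨fun j => hN y hyA j, fun j => ?_⟩
    have hyα' : ∑ i, a i * (z i ⬝ᵥ y) ≤ α := by
      rw [← sum_smul_dotProduct_eq]; exact hyα
    have h1 : a j * (z j ⬝ᵥ y - N) ≤ ∑ i, a i * (z i ⬝ᵥ y - N) :=
      Finset.single_le_sum (f := fun i => a i * (z i ⬝ᵥ y - N))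
        (fun i _ => mul_nonneg (ha i).le (sub_nonneg.2 (hN y hyA i))) (Finset.mem_univ j)
    simp only [mul_sub, Finset.sum_sub_distrib] at h1
    change z j ⬝ᵥ y ≤ N + (α - ∑ i, a i * N) / a j
    rw [← sub_le_iff_le_add', le_div_iff₀ (ha j)]
    linarith
  obtain ⟨y₁, hy₁⟩ := hne
  obtain ⟨v₀, hv₀, hmin⟩ := (hcomp (w ⬝ᵥ y₁)).exists_isMinOn ⟨y₁, hy₁, le_refl (w ⬝ᵥ y₁)⟩
    (continuous_dotProduct_right w).continuousOn
  have hmin' : ∀ y ∈ A, w ⬝ᵥ v₀ ≤ w ⬝ᵥ y := by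
    intro y hy
    by_cases h : w ⬝ᵥ y ≤ w ⬝ᵥ y₁
    · exact hmin ⟨hy, h⟩
    · exact (show w ⬝ᵥ v₀ ≤ w ⬝ᵥ y₁ from hv₀.2).trans (not_le.1 h).le
  obtain ⟨v, hv⟩ := (hcomp (w ⬝ᵥ v₀)).extremePoints_nonempty ⟨v₀, hv₀.1, le_refl (w ⬝ᵥ v₀)⟩
  have hvle : w ⬝ᵥ v ≤ w ⬝ᵥ v₀ := hv.1.2
  refine ⟨v, ?_, fun y hy => hvle.trans (hmin' y hy)⟩
  rw [mem_extremePoints_iff_left] at hv ⊢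
  refine ⟨hv.1.1, fun x₁ hx₁ x₂ hx₂ hseg => ?_⟩
  have h1 := hmin' x₁ hx₁
  have h2 := hmin' x₂ hx₂
  obtain ⟨s, t, hs, ht, hst, hx⟩ := id hseg
  have hval : s * (w ⬝ᵥ x₁) + t * (w ⬝ᵥ x₂) = w ⬝ᵥ v := by
    rw [← hx]; simp [dotProduct_add, dotProduct_smul]
  have hsum : s * (w ⬝ᵥ v₀) + t * (w ⬝ᵥ v₀) = w ⬝ᵥ v₀ := by rw [← add_mul, hst, one_mul]
  -- A point of the segment is a minimizer only if both end points are.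
  have e1 : w ⬝ᵥ x₁ ≤ w ⬝ᵥ v₀ := by
    refine le_of_mul_le_mul_left ?_ hs
    have := mul_le_mul_of_nonneg_left h2 ht.le
    linarith
  have e2 : w ⬝ᵥ x₂ ≤ w ⬝ᵥ v₀ := by
    refine le_of_mul_le_mul_left ?_ ht
    have := mul_le_mul_of_nonneg_left h1 hs.le
    linarith
  exact hv.2 x₁ ⟨hx₁, e1⟩ x₂ ⟨hx₂, e2⟩ hseg

/-- A closed set bounded below with respect to `C` lies in every closed convex set `Q` that contains
its extreme points and satisfies `Q + C ⊆ Q`. A point outside `Q` would be separated from `Q` by a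
functional in `C⁺`; a small perturbation into the interior of `C⁺` attains its minimum over `A` at
an extreme point. -/
lemma subset_of_extremePoints_subset {k J : ℕ} {C : PointedCone ℝ (Fin k → ℝ)}
    {z : Fin J → (Fin k → ℝ)} (hsep : ∀ d, (∀ j, z j ⬝ᵥ d = 0) → d = 0)
    (hdual : dualCone C = {w | ∃ a : Fin J → ℝ, (∀ j, 0 ≤ a j) ∧ w = ∑ j, a j • z j})
    {A Q : Set (Fin k → ℝ)} (hA : IsClosed A) {N : ℝ} (hN : ∀ y ∈ A, ∀ j, N ≤ z j ⬝ᵥ y)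
    (hQ : IsClosed Q) (hQconv : Convex ℝ Q) (hQC : ∀ y ∈ Q, ∀ d ∈ C, y + d ∈ Q)
    (hext : extremePoints ℝ A ⊆ Q) : A ⊆ Q := by
  intro y hy
  by_contra hyQ
  obtain ⟨f, u, hfy, hfQ⟩ := geometric_hahn_banach_point_closed hQconv hQ hyQ
  obtain ⟨w, hw⟩ := exists_dotProduct_eq f.toLinearMap
  replace hfy : w ⬝ᵥ y < u := by rw [← hw]; exact hfy
  replace hfQ : ∀ b ∈ Q, u < w ⬝ᵥ b := fun b hb => by rw [← hw]; exact hfQ b hb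
  obtain ⟨q, hq, -⟩ := exists_extremePoint_isMinOn hsep hA ⟨y, hy⟩ hN (a := fun _ => 1)
    (fun _ => one_pos)
  have hwC : w ∈ dualCone C := by
    intro d hd
    by_contra! hneg
    have hqu := hfQ q (hext hq)
    have ht : 0 ≤ (w ⬝ᵥ q - u) / -(w ⬝ᵥ d) := div_nonneg (by linarith) (by linarith)
    have h1 := hfQ _ (hQC q (hext hq) _ (C.smul_mem ht hd))
    rw [dotProduct_add, dotProduct_smul, smul_eq_mul, div_neg, neg_mul,
      div_mul_cancel₀ _ hneg.ne] at h1
    linarith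
  rw [hdual] at hwC
  obtain ⟨a, ha, rfl⟩ := hwC
  set w := ∑ j, a j • z j with hwdef
  set gap := u - w ⬝ᵥ y with hgap
  have hgap0 : 0 < gap := by linarith
  set S := ∑ j, z j ⬝ᵥ y - ∑ _j : Fin J, N with hS
  have hS0 : 0 ≤ S := by
    rw [hS, ← Finset.sum_sub_distrib]
    exact Finset.sum_nonneg fun j _ => sub_nonneg.2 (hN y hy j)
  -- `δ` is so small that the perturbation by `δ ∑ z j` does not use up the separation gap.
  set δ := gap / (S + 1) with hδ
  have hδ0 : 0 < δ := div_pos hgap0 (by linarith)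
  have hδS : δ * S < gap := by
    rw [hδ, div_mul_eq_mul_div, div_lt_iff₀ (by linarith)]
    nlinarith
  obtain ⟨v, hv, hvmin⟩ := exists_extremePoint_isMinOn hsep hA ⟨y, hy⟩ hN
    (a := fun j => a j + δ) (fun j => add_pos_of_nonneg_of_pos (ha j) hδ0)
  have hexp : ∀ x, (∑ j, (a j + δ) • z j) ⬝ᵥ x = w ⬝ᵥ x + δ * ∑ j, z j ⬝ᵥ x := by
    intro x
    rw [sum_smul_dotProduct_eq, hwdef, sum_smul_dotProduct_eq, Finset.mul_sum,
      ← Finset.sum_add_distrib]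
    exact Finset.sum_congr rfl fun j _ => by ring
  have h1 := hvmin y hy
  rw [hexp, hexp] at h1
  have h2 := hfQ v (hext hv)
  have h3 : ∑ _j : Fin J, N ≤ ∑ j, z j ⬝ᵥ v := Finset.sum_le_sum fun j _ => hN v hv.1 j
  have h4 := mul_le_mul_of_nonneg_left h3 hδ0.le
  have h5 : δ * ∑ j, z j ⬝ᵥ y = δ * S + δ * ∑ _j : Fin J, N := by rw [hS]; ring
  linarith

/-! ### The parametrization of normalized weights -/

section Weights

variable {r : ℕ} {c' : Fin r → (Fin (r + 1) → ℝ)} {c : Fin (r + 1) → ℝ}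

lemma isUnit_matT (hT : LinearIndependent ℝ (frame c' c)) : IsUnit (matT c' c) :=
  linearIndependent_cols_iff_isUnit.1 hT

lemma transpose_matT_mulVec_last (c' : Fin r → (Fin (r + 1) → ℝ)) (c w : Fin (r + 1) → ℝ) :
    ((matT c' c)ᵀ *ᵥ w) (Fin.last r) = w ⬝ᵥ c := by
  simp only [mulVec, matT, frame, dotProduct, transpose_apply, of_apply, Fin.snoc_last]
  exact Finset.sum_congr rfl fun i _ => mul_comm _ _

lemma wt_update_last (c' : Fin r → (Fin (r + 1) → ℝ)) (c t : Fin (r + 1) → ℝ) (a : ℝ) :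
    wt c' c (Function.update t (Fin.last r) a) = wt c' c t := by
  simp [wt]

lemma transpose_matT_mulVec_wt (hT : LinearIndependent ℝ (frame c' c)) (t : Fin (r + 1) → ℝ) :
    (matT c' c)ᵀ *ᵥ wt c' c t = Function.update t (Fin.last r) 1 := by
  rw [mulVec_transpose, wt, vecMul_vecMul,
    nonsing_inv_mul _ ((isUnit_iff_isUnit_det _).1 (isUnit_matT hT)), vecMul_one]

lemma wt_transpose_matT_mulVec (hT : LinearIndependent ℝ (frame c' c)) {w : Fin (r + 1) → ℝ}
    (hw : w ⬝ᵥ c = 1) : wt c' c ((matT c' c)ᵀ *ᵥ w) = w := by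
  have h : Function.update ((matT c' c)ᵀ *ᵥ w) (Fin.last r) 1 = (matT c' c)ᵀ *ᵥ w := by
    rw [← hw, ← transpose_matT_mulVec_last c' c w, Function.update_eq_self]
  rw [wt, h, mulVec_transpose, vecMul_vecMul,
    mul_nonsing_inv _ ((isUnit_iff_isUnit_det _).1 (isUnit_matT hT)), vecMul_one]

lemma wt_dotProduct (hT : LinearIndependent ℝ (frame c' c)) (t : Fin (r + 1) → ℝ) :
    wt c' c t ⬝ᵥ c = 1 := by
  rw [← transpose_matT_mulVec_last c' c, transpose_matT_mulVec_wt hT, Function.update_self]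

end Weights

namespace CVOP

variable {n m r : ℕ} (P : CVOP n m r)

/-- The optimal value `inf {wᵀ Γ(x) : x ∈ 𝒳}` of the weighted sum scalarization; the last
coordinate of the dual objective. -/
noncomputable def scalarInf (w : Fin (r + 1) → ℝ) : ℝ := sInf ((fun x => w ⬝ᵥ P.Γ x) '' P.feasible)

variable {P}

lemma isCompact_image_Γ (hP : P.Assumption) : IsCompact (P.Γ '' P.feasible) :=
  hP.compact.image_of_continuousOn (hP.continuous.mono fun _ hx => hx.1)

lemma nonempty_feasible (P : CVOP n m r) : P.feasible.Nonempty := P.feasible_nonempty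

lemma scalarInf_le (hP : P.Assumption) (w : Fin (r + 1) → ℝ) {x : Fin n → ℝ}
    (hx : x ∈ P.feasible) : P.scalarInf w ≤ w ⬝ᵥ P.Γ x := by
  refine csInf_le ?_ (mem_image_of_mem _ hx)
  rw [← image_image (fun y => w ⬝ᵥ y) P.Γ]
  exact ((isCompact_image_Γ hP).image (continuous_dotProduct_right w)).bddBelow

lemma le_scalarInf {w : Fin (r + 1) → ℝ} {a : ℝ} (h : ∀ x ∈ P.feasible, a ≤ w ⬝ᵥ P.Γ x) :
    a ≤ P.scalarInf w := by
  refine le_csInf ((nonempty_feasible P).image _) ?_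
  rintro _ ⟨x, hx, rfl⟩
  exact h x hx

lemma mem_feasible_iff (hP : P.Assumption) {x : Fin n → ℝ} :
    x ∈ P.feasible ↔ x ∈ P.X ∧ ∀ i, P.g x i ≤ 0 := by
  have h : coneLE P.D (P.g x) 0 ↔ ∀ i, P.g x i ≤ 0 := by
    rw [coneLE, ← SetLike.mem_coe, hP.orthant]
    simp
  rw [feasible, mem_ofPred_eq, h]

lemma isClosed_cone (hP : P.Assumption) : IsClosed (P.C : Set (Fin (r + 1) → ℝ)) := by
  obtain ⟨s, w, γ, -, h⟩ := hP.polyhedral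
  rw [h]
  exact isClosed_iInter fun i => isClosed_le continuous_const (continuous_dotProduct_right _)

/-- Half-spaces with normals `w ∈ C⁺` and levels `scalarInf w` contain the upper image. -/
lemma upperImage_subset_halfspace (hP : P.Assumption) {w : Fin (r + 1) → ℝ}
    (hw : w ∈ dualCone P.C) : P.upperImage ⊆ {y | P.scalarInf w ≤ w ⬝ᵥ y} := by
  refine closure_minimal ?_ (isClosed_le continuous_const (continuous_dotProduct_right w))
  rintro _ ⟨_, ⟨x, hx, rfl⟩, d, hd, rfl⟩
  change P.scalarInf w ≤ w ⬝ᵥ (P.Γ x + d)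
  rw [dotProduct_add]
  have := scalarInf_le hP w hx
  have := hw d hd
  linarith

/-! ### Dual feasible points -/

variable {c' : Fin r → (Fin (r + 1) → ℝ)} {c : Fin (r + 1) → ℝ}

lemma dualObj_eq (P : CVOP n m r) (hT : LinearIndependent ℝ (frame c' c)) (t : Fin (r + 1) → ℝ) :
    P.dualObj c' c t = (matT c' c)ᵀ *ᵥ wt c' c t + (P.scalarInf (wt c' c t) - 1) • eLast := by
  rw [transpose_matT_mulVec_wt hT]
  ext i
  by_cases h : i = Fin.last r
  · subst h; simp [dualObj, eLast, scalarInf]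
  · simp [dualObj, eLast, h]

lemma mem_cutHalfspace_iff (P : CVOP n m r) (c' : Fin r → (Fin (r + 1) → ℝ))
    (c t y : Fin (r + 1) → ℝ) :
    y ∈ cutHalfspace P c' c t ↔ P.scalarInf (wt c' c t) ≤ wt c' c t ⬝ᵥ y := by
  simp [cutHalfspace, phi, dualObj, wt_update_last, scalarInf]

lemma isClosed_cutHalfspace (P : CVOP n m r) (c' : Fin r → (Fin (r + 1) → ℝ))
    (c t : Fin (r + 1) → ℝ) : IsClosed (cutHalfspace P c' c t) := by
  have h : cutHalfspace P c' c t = {y | P.scalarInf (wt c' c t) ≤ wt c' c t ⬝ᵥ y} := by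
    ext y; exact mem_cutHalfspace_iff P c' c t y
  rw [h]
  exact isClosed_le continuous_const (continuous_dotProduct_right _)

lemma cutHalfspace_ne_univ (P : CVOP n m r) (hT : LinearIndependent ℝ (frame c' c))
    (t : Fin (r + 1) → ℝ) : cutHalfspace P c' c t ≠ univ := by
  intro h
  have hmem : (P.scalarInf (wt c' c t) - 1) • c ∈ cutHalfspace P c' c t := h ▸ mem_univ _
  rw [mem_cutHalfspace_iff, dotProduct_smul, wt_dotProduct hT, smul_eq_mul] at hmem
  linarith

lemma transpose_matT_mulVec_mem_dualFeasible (hT : LinearIndependent ℝ (frame c' c))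
    {w : Fin (r + 1) → ℝ} (hwc : w ⬝ᵥ c = 1) (hw : w ∈ dualCone P.C) :
    (matT c' c)ᵀ *ᵥ w ∈ P.dualFeasible c' c := by
  rw [dualFeasible, mem_ofPred_eq, wt_transpose_matT_mulVec hT hwc]
  exact hw

/-- Every dual feasible point is a maximizer: comparability with respect to `K` fixes the first
`q - 1` coordinates, and these determine the weight `w(t)` and hence the dual objective. -/
lemma isMaximizer_of_mem_dualFeasible {t : Fin (r + 1) → ℝ} (ht : t ∈ P.dualFeasible c' c) :
    P.IsMaximizer c' c t := by
  refine ⟨ht, ?_⟩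
  rintro ⟨s, -, ⟨a, -, ha⟩, hne⟩
  apply hne
  have hst : ∀ i, i ≠ Fin.last r → s i = t i := by
    intro i hi
    have := congrFun ha i
    simp [dualObj, eLast, hi] at this
    linarith
  have hwt : wt c' c s = wt c' c t := by
    have : Function.update s (Fin.last r) 1 = Function.update t (Fin.last r) (1 : ℝ) := by
      ext i
      by_cases h : i = Fin.last r
      · subst h; simp
      · simp [h, hst i h]
    rw [wt, this, wt]
  ext i
  by_cases h : i = Fin.last r
  · subst h; simp [dualObj, hwt]
  · simp [dualObj, h, hst i h]

/-! ### Weak minimizers -/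

variable {J : ℕ} {z : Fin J → (Fin (r + 1) → ℝ)}

lemma isWeakMinimizer_of_isOptimalP1 {w : Fin (r + 1) → ℝ} (hw : w ∈ dualCone P.C)
    (hwc : w ⬝ᵥ c = 1) {x : Fin n → ℝ} (hx : P.IsOptimalP1 w x) : P.IsWeakMinimizer x := by
  refine ⟨hx.1, mem_image_of_mem _ hx.1, eq_empty_iff_forall_notMem.2 ?_⟩
  rintro _ ⟨⟨_, rfl, d, hd, rfl⟩, x', hx', he⟩
  obtain ⟨δ, hδ, hmem⟩ := exists_sub_smul_mem hd c
  have h1 := hw _ hmem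
  have h2 := hx.2 x' hx'
  rw [dotProduct_sub, dotProduct_smul, hwc, smul_eq_mul] at h1
  rw [he] at h2
  simp only [dotProduct_sub] at h2
  linarith

/-- An optimal `x` for `(P₂(v))` is a weak minimizer: a feasible point better by an interior
direction of `C` would allow a strictly smaller `s`. -/
lemma isWeakMinimizer_of_isOptimalP2 (hP : P.Assumption)
    (hz : IsNormalizedDualGenerators P.C c z) {v : Fin (r + 1) → ℝ} {x : Fin n → ℝ} {s : ℝ}
    (hx : P.IsOptimalP2 z c v x s) : P.IsWeakMinimizer x := by
  have hxf : x ∈ P.feasible := (mem_feasible_iff hP).2 ⟨hx.1.1, hx.1.2.1⟩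
  refine ⟨hxf, mem_image_of_mem _ hxf, eq_empty_iff_forall_notMem.2 ?_⟩
  rintro _ ⟨⟨_, rfl, d, hd, rfl⟩, x', hx', he⟩
  obtain ⟨δ, hδ, hmem⟩ := exists_sub_smul_mem hd c
  have hx'' := (mem_feasible_iff hP).1 hx'
  have h := hx.2 x' (s - δ) ⟨hx''.1, hx''.2, fun j => ?_⟩
  · linarith
  have h1 := hz.mem_dualCone j _ hmem
  have h2 := hx.1.2.2 j
  simp only [he, sub_smul, dotProduct_sub] at h1 h2 ⊢
  linarith

/-! ### Inner and outer approximations -/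

/-- The problem is bounded, with lower bound `N c` for `N` below all values `z jᵀ Γ(x)`. -/
lemma isBoundedProblem (hP : P.Assumption) (hz : IsNormalizedDualGenerators P.C c z) :
    P.IsBoundedProblem := by
  obtain ⟨N, hN⟩ : ∃ N : ℝ, ∀ j, N ≤ P.scalarInf (z j) := by
    obtain ⟨N, hN⟩ := (Set.finite_range fun j => P.scalarInf (z j)).bddBelow
    exact ⟨N, fun j => hN ⟨j, rfl⟩⟩
  refine ⟨N • c, fun y hy => ⟨N • c, rfl, y - N • c, ?_, by simp⟩⟩
  rw [SetLike.mem_coe, mem_cone_iff_forall_generators hP.polyhedral hz]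
  intro j
  have h1 : P.scalarInf (z j) ≤ z j ⬝ᵥ y :=
    upperImage_subset_halfspace hP (hz.mem_dualCone j) hy
  rw [dotProduct_sub, dotProduct_smul, dotProduct_comm (z j) c, hz.1 j, smul_eq_mul]
  linarith [hN j]

/-- The `ε`-relaxed inner approximation `conv Γ(X̄) + C - ε {c}`. -/
def innerApprox (P : CVOP n m r) (c : Fin (r + 1) → ℝ) (ε : ℝ) (Xbar : Set (Fin n → ℝ)) :
    Set (Fin (r + 1) → ℝ) :=
  convexHull ℝ (P.Γ '' Xbar) + (P.C : Set (Fin (r + 1) → ℝ)) - {ε • c}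

lemma isClosed_innerApprox (hP : P.Assumption) (ε : ℝ) {Xbar : Set (Fin n → ℝ)}
    (hX : Xbar.Finite) : IsClosed (P.innerApprox c ε Xbar) := by
  have h : IsClosed (convexHull ℝ (P.Γ '' Xbar) + (P.C : Set (Fin (r + 1) → ℝ))) :=
    (isClosed_cone hP).add_left_of_isCompact ((hX.image P.Γ).isCompact_convexHull ℝ)
  rw [innerApprox, sub_eq_add_neg]
  exact h.add_right_of_isCompact (by simp)

lemma convex_innerApprox (P : CVOP n m r) (c : Fin (r + 1) → ℝ) (ε : ℝ)
    (Xbar : Set (Fin n → ℝ)) : Convex ℝ (P.innerApprox c ε Xbar) :=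
  ((convex_convexHull ℝ _).add (PointedCone.convex P.C)).sub (convex_singleton _)

lemma add_mem_innerApprox {ε : ℝ} {Xbar : Set (Fin n → ℝ)} {y d : Fin (r + 1) → ℝ}
    (hy : y ∈ P.innerApprox c ε Xbar) (hd : d ∈ P.C) : y + d ∈ P.innerApprox c ε Xbar := by
  obtain ⟨_, ⟨p, hp, e, he, rfl⟩, _, rfl, rfl⟩ := hy
  refine ⟨_, ⟨p, hp, e + d, P.C.add_mem he hd, rfl⟩, _, rfl, ?_⟩
  simp only
  abel

/-- A point `v` at which `(P₂(v))` has a feasible pair `(x, s)` with `s ≤ ε` and `x ∈ X̄` lies in the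
`ε`-relaxed inner approximation. -/
lemma mem_innerApprox_of_isFeasibleP2 (hP : P.Assumption)
    (hz : IsNormalizedDualGenerators P.C c z) {ε : ℝ} {Xbar : Set (Fin n → ℝ)}
    {v : Fin (r + 1) → ℝ} {x : Fin n → ℝ} {s : ℝ} (hx : P.IsFeasibleP2 z c v x s) (hs : s ≤ ε)
    (hmem : x ∈ Xbar) : v ∈ P.innerApprox c ε Xbar := by
  refine ⟨_, ⟨P.Γ x, subset_convexHull ℝ _ (mem_image_of_mem _ hmem), v + ε • c - P.Γ x, ?_, rfl⟩,
    _, rfl, by simp⟩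
  rw [SetLike.mem_coe, mem_cone_iff_forall_generators hP.polyhedral hz]
  intro j
  have h := hx.2.2 j
  simp only [dotProduct_sub, dotProduct_add, dotProduct_smul, dotProduct_comm (z j) c, hz.1 j,
    smul_eq_mul, mul_one] at h ⊢
  linarith

lemma scalarInf_sub_le_of_mem_innerApprox (hP : P.Assumption) {ε : ℝ} {Xbar : Set (Fin n → ℝ)}
    (hX : Xbar ⊆ P.feasible) {w y : Fin (r + 1) → ℝ} (hw : w ∈ dualCone P.C) (hwc : w ⬝ᵥ c = 1)
    (hy : y ∈ P.innerApprox c ε Xbar) : P.scalarInf w - ε ≤ w ⬝ᵥ y := by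
  obtain ⟨_, ⟨p, hp, e, he, rfl⟩, _, rfl, rfl⟩ := hy
  have hp' : p ∈ {p | P.scalarInf w ≤ w ⬝ᵥ p} := by
    refine convexHull_min ?_ (convex_halfSpace_ge ⟨fun a b => dotProduct_add w a b,
      fun a b => dotProduct_smul a w b⟩ _) hp
    rintro _ ⟨x, hx, rfl⟩
    exact scalarInf_le hP w (hX hx)
  have he' := hw e he
  simp only [mem_ofPred_eq, dotProduct_sub, dotProduct_add, dotProduct_smul, hwc, smul_eq_mul,
    mul_one] at hp' ⊢
  linarith

/-- Linear programming duality for the cuts: if every `y` satisfying the cuts of the finite set `T̄`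
has `wᵀ y ≥ inf wᵀ Γ - ε` for all normalized `w ∈ C⁺`, then `T̄` is a finite `ε`-supremizer. A point
of the lower image outside the relaxed convex hull would be separated from it by a functional whose
last component is positive, because every normalized weight is a convex combination of the `z j`,
which are among the weights of `T̄`; after normalization, the separating hyperplane yields a
violating `y`. -/
lemma isFiniteEpsSupremizer_of_cuts (hT : LinearIndependent ℝ (frame c' c))
    (hz : IsNormalizedDualGenerators P.C c z) {ε : ℝ} {Tbar : Set (Fin (r + 1) → ℝ)}
    (hne : Tbar.Nonempty) (hfin : Tbar.Finite) (hfeas : Tbar ⊆ P.dualFeasible c' c)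
    (hzT : ∀ j, (matT c' c)ᵀ *ᵥ z j ∈ Tbar)
    (hcut : ∀ y, (∀ t ∈ Tbar, y ∈ cutHalfspace P c' c t) →
      ∀ w ∈ dualCone P.C, w ⬝ᵥ c = 1 → P.scalarInf w - ε ≤ w ⬝ᵥ y) :
    P.IsFiniteEpsSupremizer c' c ε Tbar := by
  refine ⟨hne, hfin, hfeas, ?_⟩
  set H := convexHull ℝ (P.dualObj c' c '' Tbar) with hH
  have hKconv : Convex ℝ (coneK (r := r)) := by
    rintro _ ⟨a, ha, rfl⟩ _ ⟨b, hb, rfl⟩ s t hs ht -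
    exact ⟨s * a + t * b, by positivity, by rw [add_smul, mul_smul, mul_smul]⟩
  have hKclosed : IsClosed (coneK (r := r)) := by
    have : coneK (r := r) = (fun a : ℝ => a • eLast (r := r)) '' Ici 0 := by
      ext y; simp [coneK, eq_comm]
    rw [this]
    exact (isClosedEmbedding_smul_left (𝕜 := ℝ) (show eLast (r := r) ≠ 0 by
      simp [eLast])).isClosedMap _ isClosed_Ici
  have hclosed : IsClosed (H - coneK) := by
    rw [sub_eq_add_neg]
    exact hKclosed.neg.add_left_of_isCompact ((hfin.image _).isCompact_convexHull ℝ)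
  have hconv : Convex ℝ (H - coneK) := (convex_convexHull ℝ _).sub hKconv
  rintro _ ⟨_, ⟨t, ht, rfl⟩, _, ⟨a, ha, rfl⟩, rfl⟩
  suffices hmem : P.dualObj c' c t - a • eLast - ε • eLast ∈ H - coneK from
    ⟨_, hmem, _, rfl, by simp⟩
  by_contra hnot
  obtain ⟨f, β, hfH, hfp⟩ := geometric_hahn_banach_closed_point hconv hclosed hnot
  obtain ⟨h, hh⟩ := exists_dotProduct_eq f.toLinearMap
  replace hfH : ∀ b ∈ H - coneK, h ⬝ᵥ b < β := fun b hb => by rw [← hh]; exact hfH b hb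
  replace hfp : β < h ⬝ᵥ (P.dualObj c' c t - a • eLast - ε • eLast) := by
    rw [← hh]; exact hfp
  set l := h (Fin.last r) with hl
  have hlast : h ⬝ᵥ eLast = l := by simp [eLast, hl]
  -- The functional `h` expressed through the weight and the optimal value.
  have hobj : ∀ τ, h ⬝ᵥ P.dualObj c' c τ =
      wt c' c τ ⬝ᵥ (matT c' c *ᵥ h) + (P.scalarInf (wt c' c τ) - 1) * l := by
    intro τ
    rw [dualObj_eq P hT, dotProduct_add, dotProduct_smul, hlast, smul_eq_mul, mulVec_transpose,
      dotProduct_comm h, ← dotProduct_mulVec]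
  have hTbar : ∀ τ ∈ Tbar, ∀ b : ℝ, 0 ≤ b → h ⬝ᵥ P.dualObj c' c τ - b * l < β := by
    intro τ hτ b hb
    have := hfH _ ⟨_, subset_convexHull ℝ _ (mem_image_of_mem _ hτ), b • eLast, ⟨b, hb, rfl⟩, rfl⟩
    simpa only [dotProduct_sub, dotProduct_smul, hlast, smul_eq_mul] using this
  rw [dotProduct_sub, dotProduct_sub, dotProduct_smul, dotProduct_smul, hlast, hobj, smul_eq_mul,
    smul_eq_mul] at hfp
  have hwc := wt_dotProduct hT t
  have hl0 : 0 ≤ l := by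
    by_contra! hneg
    obtain ⟨τ, hτ⟩ := hne
    have h0 := hTbar τ hτ 0 le_rfl
    have h1 := hTbar τ hτ ((β - h ⬝ᵥ P.dualObj c' c τ) / -l)
      (div_nonneg (by linarith) (by linarith))
    rw [div_neg, neg_mul, div_mul_cancel₀ _ hneg.ne] at h1
    linarith
  rcases hl0.eq_or_lt with hl0 | hl0
  · -- A vertical separating hyperplane is impossible, as `w(t)` is a convex combination of the `z j`.
    have hw : wt c' c t ∈ dualCone P.C := ht
    rw [hz.2] at hw
    obtain ⟨b, hb, hwb⟩ := hw
    have hsum : ∑ j, b j = 1 := by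
      rw [← hwc, hwb, sum_smul_dotProduct_eq]
      exact Finset.sum_congr rfl fun j _ => by rw [dotProduct_comm, hz.1 j, mul_one]
    have hle : wt c' c t ⬝ᵥ (matT c' c *ᵥ h) ≤ ∑ j, b j * β := by
      rw [hwb, sum_smul_dotProduct_eq]
      refine Finset.sum_le_sum fun j _ => mul_le_mul_of_nonneg_left ?_ (hb j)
      have h1 := hTbar _ (hzT j) 0 le_rfl
      rw [hobj, wt_transpose_matT_mulVec hT (by rw [dotProduct_comm]; exact hz.1 j), ← hl0] at h1
      linarith
    rw [← Finset.sum_mul, hsum] at hle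
    rw [← hl0] at hfp
    linarith
  · -- The point where all cuts hold although the weight `w(t)` has too small a value.
    set y : Fin (r + 1) → ℝ := l⁻¹ • ((β + l) • c - matT c' c *ᵥ h) with hy
    have hval : ∀ τ, l * (wt c' c τ ⬝ᵥ y) = β + l - wt c' c τ ⬝ᵥ (matT c' c *ᵥ h) := by
      intro τ
      rw [hy, dotProduct_smul, smul_eq_mul, mul_inv_cancel_left₀ hl0.ne', dotProduct_sub,
        dotProduct_smul, wt_dotProduct hT, smul_eq_mul, mul_one]
    have hycut : ∀ τ ∈ Tbar, y ∈ cutHalfspace P c' c τ := by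
      intro τ hτ
      rw [mem_cutHalfspace_iff]
      refine le_of_mul_le_mul_left ?_ hl0
      have h1 := hTbar τ hτ 0 le_rfl
      rw [hobj] at h1
      rw [hval]
      linarith
    have h2 := mul_le_mul_of_nonneg_left (hcut y hycut _ ht hwc) hl0.le
    rw [hval] at h2
    have h3 : 0 ≤ a * l := mul_nonneg ha hl0.le
    linarith

end CVOP

/-! ### Invariants of the algorithm -/

section Invariants

variable {n m r J : ℕ} {P : CVOP n m r} {c' : Fin r → (Fin (r + 1) → ℝ)} {c : Fin (r + 1) → ℝ}
  {z : Fin J → (Fin (r + 1) → ℝ)} {ε : ℝ} {brk : Bool}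

/-- The collected sets are finite and consist of weak minimizers and dual feasible points. -/
structure IsSound (P : CVOP n m r) (c' : Fin r → (Fin (r + 1) → ℝ)) (c : Fin (r + 1) → ℝ)
    (Xbar : Set (Fin n → ℝ)) (Tbar : Set (Fin (r + 1) → ℝ)) : Prop where
  finite_X : Xbar.Finite
  weakMin : ∀ x ∈ Xbar, P.IsWeakMinimizer x
  finite_T : Tbar.Finite
  feasible_T : Tbar ⊆ P.dualFeasible c' c

/-- The polyhedron `{y : φ(y, D*(t)) ≥ 0 ∀ t ∈ T̄}` of all points satisfying the cuts of `T̄`. -/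
def cutPolyhedron (P : CVOP n m r) (c' : Fin r → (Fin (r + 1) → ℝ)) (c : Fin (r + 1) → ℝ)
    (Tbar : Set (Fin (r + 1) → ℝ)) : Set (Fin (r + 1) → ℝ) :=
  {y | ∀ t ∈ Tbar, y ∈ cutHalfspace P c' c t}

lemma upperImage_subset_cutPolyhedron (hP : P.Assumption) {Tbar : Set (Fin (r + 1) → ℝ)}
    (hTbar : Tbar ⊆ P.dualFeasible c' c) : P.upperImage ⊆ cutPolyhedron P c' c Tbar := by
  intro y hy t ht
  rw [CVOP.mem_cutHalfspace_iff]
  exact CVOP.upperImage_subset_halfspace hP (hTbar ht) hy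

lemma cutPolyhedron_anti {S T : Set (Fin (r + 1) → ℝ)} (h : S ⊆ T) :
    cutPolyhedron P c' c T ⊆ cutPolyhedron P c' c S :=
  fun _ hy t ht => hy t (h ht)

lemma IsSound.insert (hP : P.Assumption) (hT : LinearIndependent ℝ (frame c' c))
    (hz : IsNormalizedDualGenerators P.C c z) {Xbar : Set (Fin n → ℝ)}
    {Tbar : Set (Fin (r + 1) → ℝ)} (h : IsSound P c' c Xbar Tbar) {v : Fin (r + 1) → ℝ}
    {x : Fin n → ℝ} {s : ℝ} {u : Fin m → ℝ} {w : Fin (r + 1) → ℝ}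
    (hP2 : P.IsOptimalP2 z c v x s) (hD2 : P.IsOptimalD2 c v u w) :
    IsSound P c' c (insert x Xbar) (insert ((matT c' c)ᵀ *ᵥ w) Tbar) where
  finite_X := h.finite_X.insert x
  weakMin := by
    rintro y (rfl | hy)
    · exact CVOP.isWeakMinimizer_of_isOptimalP2 hP hz hP2
    · exact h.weakMin y hy
  finite_T := h.finite_T.insert _
  feasible_T := insert_subset
    (CVOP.transpose_matT_mulVec_mem_dualFeasible hT hD2.1.2.1 hD2.1.2.2) h.feasible_T

lemma ForLoop.isSound (hP : P.Assumption) (hT : LinearIndependent ℝ (frame c' c))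
    (hz : IsNormalizedDualGenerators P.C c z) {vs : List (Fin (r + 1) → ℝ)}
    {st st' : LoopState n r} (h : ForLoop P c' c z ε brk vs st st')
    (hst : IsSound P c' c st.Xbar st.Tbar) : IsSound P c' c st'.Xbar st'.Tbar := by
  induction h with
  | done st => exact hst
  | pass v vs st st' x s u w hP2 hD2 hs rest ih => exact ih (hst.insert hP hT hz hP2 hD2)
  | cut v vs st st' x s u w hP2 hD2 hs hbrk rest ih => exact ih (hst.insert hP hT hz hP2 hD2)
  | cutBreak v vs st x s u w hP2 hD2 hs hbrk => exact hst.insert hP hT hz hP2 hD2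

lemma ForLoop.mono {vs : List (Fin (r + 1) → ℝ)} {st st' : LoopState n r}
    (h : ForLoop P c' c z ε brk vs st st') :
    st.Xbar ⊆ st'.Xbar ∧ st.Tbar ⊆ st'.Tbar ∧ st'.M ⊆ st.M := by
  induction h with
  | done st => exact ⟨subset_rfl, subset_rfl, subset_rfl⟩
  | pass v vs st st' x s u w hP2 hD2 hs rest ih =>
    exact ⟨(subset_insert _ _).trans ih.1, (subset_insert _ _).trans ih.2.1, ih.2.2⟩
  | cut v vs st st' x s u w hP2 hD2 hs hbrk rest ih =>
    exact ⟨(subset_insert _ _).trans ih.1, (subset_insert _ _).trans ih.2.1,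
      ih.2.2.trans inter_subset_left⟩
  | cutBreak v vs st x s u w hP2 hD2 hs hbrk =>
    exact ⟨subset_insert _ _, subset_insert _ _, inter_subset_left⟩

lemma cutPolyhedron_insert_subset {t : Fin (r + 1) → ℝ} {M T : Set (Fin (r + 1) → ℝ)}
    (h : cutPolyhedron P c' c T ⊆ M) :
    cutPolyhedron P c' c (insert t T) ⊆ M ∩ cutHalfspace P c' c t :=
  fun _ hy => ⟨h (cutPolyhedron_anti (subset_insert _ _) hy), hy t (mem_insert _ _)⟩

/-- The accumulated cut `M` is closed and uses no half-spaces other than those of `T̄`. -/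
lemma ForLoop.isClosed_and_cutPolyhedron_subset {vs : List (Fin (r + 1) → ℝ)}
    {st st' : LoopState n r} (h : ForLoop P c' c z ε brk vs st st') (hcl : IsClosed st.M)
    (hst : cutPolyhedron P c' c st.Tbar ⊆ st.M) :
    IsClosed st'.M ∧ cutPolyhedron P c' c st'.Tbar ⊆ st'.M := by
  induction h with
  | done st => exact ⟨hcl, hst⟩
  | pass v vs st st' x s u w hP2 hD2 hs rest ih =>
    exact ih hcl ((cutPolyhedron_insert_subset hst).trans inter_subset_left)
  | cut v vs st st' x s u w hP2 hD2 hs hbrk rest ih =>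
    exact ih (hcl.inter (CVOP.isClosed_cutHalfspace P c' c _)) (cutPolyhedron_insert_subset hst)
  | cutBreak v vs st x s u w hP2 hD2 hs hbrk =>
    exact ⟨hcl.inter (CVOP.isClosed_cutHalfspace P c' c _), cutPolyhedron_insert_subset hst⟩

/-- If the loop ends with `M = ℝ^q`, no cut was made, so every vertex was visited and found to have
optimal value at most `ε`. -/
lemma ForLoop.exists_isFeasibleP2_of_eq_univ (hT : LinearIndependent ℝ (frame c' c))
    {vs : List (Fin (r + 1) → ℝ)} {st st' : LoopState n r}
    (h : ForLoop P c' c z ε brk vs st st') (hM : st'.M = univ) :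
    ∀ v ∈ vs, ∃ x ∈ st'.Xbar, ∃ s ≤ ε, P.IsFeasibleP2 z c v x s := by
  induction h with
  | done st => simp
  | pass v vs st st' x s u w hP2 hD2 hs rest ih =>
    intro v' hv'
    rcases List.mem_cons.1 hv' with rfl | hv'
    · exact ⟨x, rest.mono.1 (mem_insert _ _), s, hs, hP2.1⟩
    · exact ih hM v' hv'
  | cut v vs st st' x s u w hP2 hD2 hs hbrk rest ih =>
    refine (CVOP.cutHalfspace_ne_univ P hT ((matT c' c)ᵀ *ᵥ w) (univ_subset_iff.1 ?_)).elim
    rw [← hM]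
    exact rest.mono.2.2.trans inter_subset_right
  | cutBreak v vs st x s u w hP2 hD2 hs hbrk =>
    refine (CVOP.cutHalfspace_ne_univ P hT ((matT c' c)ᵀ *ᵥ w) (univ_subset_iff.1 ?_)).elim
    rw [← hM]
    exact inter_subset_right

/-- The invariant of the `repeat` loop: the outer approximation is closed, bounded below with
respect to `C`, and cut out by half-spaces belonging to `T̄`, which contains the points of the
generators `z j`. -/
structure StateInvariant (P : CVOP n m r) (c' : Fin r → (Fin (r + 1) → ℝ)) (c : Fin (r + 1) → ℝ)
    (z : Fin J → (Fin (r + 1) → ℝ)) (st : State n r) : Prop where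
  sound : IsSound P c' c st.Xbar st.Tbar
  nonempty_X : Nonempty (Fin J) → st.Xbar.Nonempty
  generators : ∀ j, (matT c' c)ᵀ *ᵥ z j ∈ st.Tbar
  isClosed : IsClosed st.outer
  bddBelow : ∃ N : ℝ, ∀ y ∈ st.outer, ∀ j, N ≤ z j ⬝ᵥ y
  cuts : cutPolyhedron P c' c st.Tbar ⊆ st.outer

lemma stateInvariant_initState (hT : LinearIndependent ℝ (frame c' c))
    (hz : IsNormalizedDualGenerators P.C c z) {x : Fin J → (Fin n → ℝ)}
    (hx : ∀ j, P.IsOptimalP1 (z j) (x j)) :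
    StateInvariant P c' c z (initState P c' c z x) := by
  have hzc : ∀ j, z j ⬝ᵥ c = 1 := fun j => by rw [dotProduct_comm]; exact hz.1 j
  refine ⟨⟨finite_range _, ?_, finite_range _, ?_⟩, fun ⟨j⟩ => ⟨x j, j, rfl⟩, fun j => ⟨j, rfl⟩,
    isClosed_iInter fun j => isClosed_le continuous_const (continuous_dotProduct_right _), ?_, ?_⟩
  · rintro _ ⟨j, rfl⟩
    exact CVOP.isWeakMinimizer_of_isOptimalP1 (hz.mem_dualCone j) (hzc j) (hx j)
  · rintro _ ⟨j, rfl⟩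
    exact CVOP.transpose_matT_mulVec_mem_dualFeasible hT (hzc j) (hz.mem_dualCone j)
  · obtain ⟨N, hN⟩ := (Set.finite_range fun j => z j ⬝ᵥ P.Γ (x j)).bddBelow
    exact ⟨N, fun y hy j => (hN ⟨j, rfl⟩).trans (mem_iInter.1 hy j)⟩
  · refine fun y hy => mem_iInter.2 fun j => ?_
    have h := hy _ ⟨j, rfl⟩
    rw [CVOP.mem_cutHalfspace_iff, wt_transpose_matT_mulVec hT (hzc j)] at h
    exact (CVOP.le_scalarInf (hx j).2).trans h

/-- The invariant is kept by one execution of the body of the `repeat` loop. -/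
lemma StateInvariant.bodyRun (hP : P.Assumption) (hT : LinearIndependent ℝ (frame c' c))
    (hz : IsNormalizedDualGenerators P.C c z) {st : State n r} {st' : LoopState n r}
    (h : StateInvariant P c' c z st) (hbody : BodyRun P c' c z ε brk st st') :
    StateInvariant P c' c z ⟨st'.Xbar, st'.Tbar, st.outer ∩ st'.M⟩ := by
  obtain ⟨vs, -, -, hloop⟩ := hbody
  obtain ⟨hX, hT', -⟩ := hloop.mono
  obtain ⟨hcl, hM⟩ := hloop.isClosed_and_cutPolyhedron_subset isClosed_univ (subset_univ _)
  obtain ⟨N, hN⟩ := h.bddBelow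
  exact ⟨hloop.isSound hP hT hz h.sound, fun hJ => (h.nonempty_X hJ).mono hX,
    fun j => hT' (h.generators j), h.isClosed.inter hcl, ⟨N, fun y hy => hN y hy.1⟩,
    fun y hy => ⟨h.cuts (cutPolyhedron_anti hT' hy), hM hy⟩⟩

lemma Reachable.stateInvariant (hP : P.Assumption) (hT : LinearIndependent ℝ (frame c' c))
    (hz : IsNormalizedDualGenerators P.C c z) {st : State n r}
    (h : Reachable P c' c z ε brk st) : StateInvariant P c' c z st := by
  induction h with
  | init x hx => exact stateInvariant_initState hT hz hx
  | next st st' h hbody hM ih => exact ih.bodyRun hP hT hz hbody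

end Invariants

end CVOPAlg

/-! ### Correctness of the algorithm -/

theorem mainTheorem1 {n m r J : ℕ} (P : CVOPAlg.CVOP n m r) (hP : P.Assumption)
    (c : Fin (r + 1) → ℝ) (hc : c ∈ interior (P.C : Set (Fin (r + 1) → ℝ)))
    (c' : Fin r → (Fin (r + 1) → ℝ)) (hT : LinearIndependent ℝ (CVOPAlg.frame c' c))
    (z : Fin J → (Fin (r + 1) → ℝ)) (hz : CVOPAlg.IsNormalizedDualGenerators P.C c z)
    (ε : ℝ) (hε : 0 < ε) (brk : Bool)
    (out : CVOPAlg.Output n r) (hout : CVOPAlg.Returns P c' c z ε brk out) :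
    P.IsFiniteWeakEpsSolution c ε out.Xbar ∧
      P.IsFiniteEpsDualSolution c' c ε out.Tbar := by
  obtain ⟨st, st', hreach, hbody, hM, rfl⟩ := hout
  have hinv := (hreach.stateInvariant hP hT hz).bodyRun hP hT hz hbody
  rw [hM, inter_univ] at hinv
  obtain ⟨vs, -, hvs, hloop⟩ := hbody
  have hsound : CVOPAlg.IsSound P c' c st'.Xbar st'.Tbar := hinv.sound
  have hsep : ∀ d, (∀ j, z j ⬝ᵥ d = 0) → d = 0 := fun d hd =>
    CVOPAlg.eq_zero_of_forall_generators P.cone_C.pointed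
      (CVOPAlg.mem_cone_iff_forall_generators hP.polyhedral hz) hd
  have hJ : Nonempty (Fin J) := by
    by_contra hempty
    have hc0 : c = 0 := hsep c fun j => (hempty ⟨j⟩).elim
    have h1 := CVOPAlg.wt_dotProduct hT 0
    rw [hc0, dotProduct_zero] at h1
    exact zero_ne_one h1
  have hXfeas : st'.Xbar ⊆ P.feasible := fun x hx => (hsound.weakMin x hx).1
  have hvert : extremePoints ℝ st.outer ⊆ P.innerApprox c ε st'.Xbar := by
    intro v hv
    obtain ⟨x, hx, s, hs, hfeas⟩ :=
      hloop.exists_isFeasibleP2_of_eq_univ hT hM v ((hvs v).2 hv)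
    exact CVOPAlg.CVOP.mem_innerApprox_of_isFeasibleP2 hP hz hfeas hs hx
  obtain ⟨N, hN⟩ := hinv.bddBelow
  -- All vertices lie in the relaxed inner approximation, hence so does the outer approximation.
  have houter : st.outer ⊆ P.innerApprox c ε st'.Xbar :=
    CVOPAlg.subset_of_extremePoints_subset hsep hz.2 hinv.isClosed hN
      (CVOPAlg.CVOP.isClosed_innerApprox hP ε hsound.finite_X)
      (CVOPAlg.CVOP.convex_innerApprox P c ε _)
      (fun _ hy _ hd => CVOPAlg.CVOP.add_mem_innerApprox hy hd) hvert
  have hcuts : CVOPAlg.cutPolyhedron P c' c st'.Tbar ⊆ P.innerApprox c ε st'.Xbar :=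
    subset_trans hinv.cuts houter
  refine ⟨⟨⟨CVOPAlg.CVOP.isBoundedProblem hP hz, hinv.nonempty_X hJ, hsound.finite_X, hXfeas,
    (CVOPAlg.upperImage_subset_cutPolyhedron hP hsound.feasible_T).trans hcuts⟩,
    hsound.weakMin⟩, ?_, fun t ht =>
      CVOPAlg.CVOP.isMaximizer_of_mem_dualFeasible (hsound.feasible_T ht)⟩
  obtain ⟨j⟩ := hJ
  exact CVOPAlg.CVOP.isFiniteEpsSupremizer_of_cuts hT hz ⟨_, hinv.generators j⟩ hsound.finite_T
    hsound.feasible_T hinv.generators fun y hy w hw hwc =>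
      CVOPAlg.CVOP.scalarInf_sub_le_of_mem_innerApprox hP hXfeas hw hwc (hcuts hy)
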